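/- Let $G$ be a finite simple connected graph with $n$ vertices and $m$ edges that is not isomorphic to the star $K_{1,n-1}$ (where, for $n=1$, $K_{1,0}$ denotes the one-vertex graph). Let $L(G)=D(G)-A(G)$ be the Laplacian matrix of $G$, where $D(G)$ is the diagonal matrix of vertex degrees and $A(G)$ is the adjacency matrix, and let $\mu_1(G)\ge\mu_2(G)\ge\cdots\ge\mu_n(G)=0$ be its eigenvalues, counted with multiplicity. Then $$\mu_2(G)\ \ge\ \frac{2m}{n},$$ and equality holds if and only if $n$ is even and $G$ is isomorphic to the complete bipartite graph $K_{n/2,n/2}$. -/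

import Mathlib

/-- The `k`-th largest Laplacian eigenvalue of `G`, for `1 ≤ k ≤ |V|`, counted with multiplicity:
`laplacianEigenvalue G 1 ≥ laplacianEigenvalue G 2 ≥ ⋯`. It is set to `0` outside that range.
(`Matrix.IsHermitian.eigenvalues₀` is the nonincreasing list of eigenvalues, indexed from `0`.) -/
noncomputable def laplacianEigenvalue {V : Type*} [Fintype V] [DecidableEq V]
    (G : SimpleGraph V) [DecidableRel G.Adj] (k : ℕ) : ℝ :=
  if h : 1 ≤ k ∧ k ≤ Fintype.card V then
    (G.isHermitian_lapMatrix ℝ).eigenvalues₀ ⟨k - 1, by omega⟩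
  else 0

/-! Suppose `μ₂ ≤ a`, where `a = 2m/n` is the average degree. By Courant–Fischer the form of `L - a`
is positive definite on no plane, so a reverse Cauchy–Schwarz inequality holds
(`shiftedForm_mul_le`); everything follows from well-chosen test vectors.

If `G` is regular, then `L - a = -A`, and differences of basis vectors along edges rule out
triangles and induced paths on four vertices. Connectedness then makes `G` complete bipartite, and
regularity makes it balanced.

Otherwise some `u` has degree above `a`, and all other degrees are at most `a` (`degree_le_of_ne`).
Write `2m = nk + s` with `s < n`. If `k ≤ 1`, then `G` is a star. If `k ≥ 2`, `degree_add_degree_le`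
bars edges away from `u` between vertices of nearly full degree `k`, and double counting gives a
contradiction (`false_of_edge_bound`).

Since `K_{h,h}` with `h ≥ 2` does have `μ₂ = h = 2m/n`, both the inequality and its equality case
follow. -/

/-! ### Courant–Fischer bounds for `μ₂` -/

open Matrix in
/-- An orthonormal eigenbasis of the Laplacian matrix, with the two largest eigenvalues marked. -/
theorem exists_laplacian_eigenbasis {V : Type*} [Fintype V] [DecidableEq V]
    (G : SimpleGraph V) [DecidableRel G.Adj] (hV : 2 ≤ Fintype.card V) :
    ∃ (b : V → V → ℝ) (l : V → ℝ) (p q : V), p ≠ q ∧ l q = laplacianEigenvalue G 2 ∧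
      laplacianEigenvalue G 2 ≤ l p ∧ (∀ i, i ≠ p → l i ≤ laplacianEigenvalue G 2) ∧
      (∀ i j, b i ⬝ᵥ b j = if i = j then 1 else 0) ∧
      (∀ i, G.lapMatrix ℝ *ᵥ b i = l i • b i) ∧
      ∀ x, x = ∑ i, (b i ⬝ᵥ x) • b i := by
  set hA := G.isHermitian_lapMatrix ℝ
  have hμ : laplacianEigenvalue G 2 = hA.eigenvalues₀ ⟨1, by omega⟩ := by
    unfold laplacianEigenvalue
    rw [dif_pos ⟨by norm_num, hV⟩]
  set e : Fin (Fintype.card V) ≃ V := Fintype.equivOfCardEq (Fintype.card_fin _) with he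
  have hl : ∀ i, hA.eigenvalues i = hA.eigenvalues₀ (e.symm i) := fun i => rfl
  refine ⟨fun i => (hA.eigenvectorBasis i).ofLp, hA.eigenvalues, e ⟨0, by omega⟩,
    e ⟨1, by omega⟩, ?_, ?_, ?_, ?_, ?_, ?_, ?_⟩
  · simp
  · rw [hl, hμ, Equiv.symm_apply_apply]
  · rw [hl, hμ, Equiv.symm_apply_apply]
    exact hA.eigenvalues₀_antitone (by simp [Fin.le_def])
  · intro i hi
    rw [hl, hμ]
    apply hA.eigenvalues₀_antitone
    rw [Fin.le_def]
    by_contra h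
    apply hi
    rw [← Equiv.symm_apply_eq, Fin.ext_iff]
    simp only [not_le] at h ⊢
    omega
  · intro i j
    have h := orthonormal_iff_ite.1 hA.eigenvectorBasis.orthonormal i j
    rw [← h, EuclideanSpace.inner_eq_star_dotProduct, star_trivial, dotProduct_comm]
  · exact fun i => hA.mulVec_eigenvectorBasis i
  · intro x
    have h := hA.eigenvectorBasis.sum_repr' (WithLp.toLp 2 x)
    have h2 := congrArg WithLp.ofLp h
    simp only [EuclideanSpace.inner_eq_star_dotProduct, star_trivial] at h2
    rw [WithLp.ofLp_sum] at h2
    simp only [WithLp.ofLp_smul] at h2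
    conv_lhs => rw [← h2]
    simp only [dotProduct_comm x]

theorem exists_ne_zero_add_eq_zero (a b : ℝ) : ∃ α β : ℝ, (α ≠ 0 ∨ β ≠ 0) ∧ α * a + β * b = 0 := by
  by_cases h : a = 0
  · exact ⟨1, 0, by simp, by simp [h]⟩
  · exact ⟨b, -a, Or.inr (by simpa), by ring⟩

open Matrix in
/-- Courant–Fischer: every plane contains a vector with Rayleigh quotient at most `μ₂`. -/
theorem exists_rayleigh_le_laplacianEigenvalue_two {V : Type*} [Fintype V] [DecidableEq V]
    (G : SimpleGraph V) [DecidableRel G.Adj] (hV : 2 ≤ Fintype.card V) (x y : V → ℝ) :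
    ∃ α β : ℝ, (α ≠ 0 ∨ β ≠ 0) ∧
      (α • x + β • y) ⬝ᵥ (G.lapMatrix ℝ *ᵥ (α • x + β • y)) ≤
        laplacianEigenvalue G 2 * ((α • x + β • y) ⬝ᵥ (α • x + β • y)) := by
  obtain ⟨b, l, p, q, -, -, -, hle, -, hL, hx⟩ := exists_laplacian_eigenbasis G hV
  obtain ⟨α, β, h0, h⟩ := exists_ne_zero_add_eq_zero (b p ⬝ᵥ x) (b p ⬝ᵥ y)
  refine ⟨α, β, h0, ?_⟩
  set z := α • x + β • y with hz
  have hzp : b p ⬝ᵥ z = 0 := by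
    simp only [hz, dotProduct_add, dotProduct_smul, smul_eq_mul, h]
  have h1 : z ⬝ᵥ (G.lapMatrix ℝ *ᵥ z) = ∑ i, l i * (b i ⬝ᵥ z) ^ 2 := by
    nth_rw 2 [hx z]
    rw [mulVec_sum, dotProduct_sum]
    refine Finset.sum_congr rfl fun i _ => ?_
    rw [mulVec_smul, hL, dotProduct_smul, dotProduct_smul, dotProduct_comm z, smul_eq_mul,
      smul_eq_mul]
    ring
  have h2 : z ⬝ᵥ z = ∑ i, (b i ⬝ᵥ z) ^ 2 := by
    nth_rw 2 [hx z]
    rw [dotProduct_sum]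
    refine Finset.sum_congr rfl fun i _ => ?_
    rw [dotProduct_smul, dotProduct_comm z, smul_eq_mul]
    ring
  rw [h1, h2, Finset.mul_sum]
  refine Finset.sum_le_sum fun i _ => ?_
  by_cases hi : i = p
  · simp [hi, hzp]
  · exact mul_le_mul_of_nonneg_right (hle i hi) (sq_nonneg _)

open Matrix in
/-- Courant–Fischer: a bound for the Rayleigh quotient on a hyperplane bounds `μ₂`. -/
theorem laplacianEigenvalue_two_le_of_orthogonal {V : Type*} [Fintype V] [DecidableEq V]
    (G : SimpleGraph V) [DecidableRel G.Adj] (hV : 2 ≤ Fintype.card V) (w : V → ℝ) (h : ℝ)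
    (hw : ∀ x, w ⬝ᵥ x = 0 → x ⬝ᵥ (G.lapMatrix ℝ *ᵥ x) ≤ h * (x ⬝ᵥ x)) :
    laplacianEigenvalue G 2 ≤ h := by
  obtain ⟨b, l, p, q, hpq, hlq, hlp, -, hb, hL, -⟩ := exists_laplacian_eigenbasis G hV
  obtain ⟨α, β, h0, hαβ⟩ := exists_ne_zero_add_eq_zero (w ⬝ᵥ b p) (w ⬝ᵥ b q)
  have h1 := hw (α • b p + β • b q) (by simpa [dotProduct_add, dotProduct_smul] using hαβ)
  simp only [mulVec_add, mulVec_smul, hL, dotProduct_add, add_dotProduct, dotProduct_smul,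
    smul_dotProduct, hb, hpq, hpq.symm, if_true, if_false, smul_eq_mul, hlq] at h1
  have h2 : 0 < α ^ 2 + β ^ 2 := by
    rcases h0 with h0 | h0 <;> positivity
  nlinarith [mul_le_mul_of_nonneg_right hlp (sq_nonneg α)]

/-! ### The form of `L - a` and its test vectors -/

open Matrix in
/-- The bilinear form of `L - a`. -/
noncomputable def shiftedForm {V : Type*} [Fintype V] [DecidableEq V]
    (G : SimpleGraph V) [DecidableRel G.Adj] (a : ℝ) (x y : V → ℝ) : ℝ :=
  x ⬝ᵥ (G.lapMatrix ℝ *ᵥ y) - a * (x ⬝ᵥ y)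

section ShiftedForm

variable {V : Type*} [Fintype V] [DecidableEq V] (G : SimpleGraph V) [DecidableRel G.Adj] (a : ℝ)

open Matrix

theorem shiftedForm_comm (x y : V → ℝ) : shiftedForm G a x y = shiftedForm G a y x := by
  have h : (G.lapMatrix ℝ)ᵀ = G.lapMatrix ℝ := G.isSymm_lapMatrix ℝ
  unfold shiftedForm
  rw [dotProduct_mulVec, ← mulVec_transpose, h, dotProduct_comm, dotProduct_comm x y]

theorem shiftedForm_add_left (x y z : V → ℝ) :
    shiftedForm G a (x + y) z = shiftedForm G a x z + shiftedForm G a y z := by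
  simp only [shiftedForm, add_dotProduct]
  ring

theorem shiftedForm_sub_left (x y z : V → ℝ) :
    shiftedForm G a (x - y) z = shiftedForm G a x z - shiftedForm G a y z := by
  simp only [shiftedForm, sub_dotProduct]
  ring

theorem shiftedForm_smul_left (c : ℝ) (x y : V → ℝ) :
    shiftedForm G a (c • x) y = c * shiftedForm G a x y := by
  simp only [shiftedForm, smul_dotProduct, smul_eq_mul]
  ring

theorem shiftedForm_add_right (x y z : V → ℝ) :
    shiftedForm G a x (y + z) = shiftedForm G a x y + shiftedForm G a x z := by
  rw [shiftedForm_comm, shiftedForm_add_left, shiftedForm_comm G a y, shiftedForm_comm G a z]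

theorem shiftedForm_sub_right (x y z : V → ℝ) :
    shiftedForm G a x (y - z) = shiftedForm G a x y - shiftedForm G a x z := by
  rw [shiftedForm_comm, shiftedForm_sub_left, shiftedForm_comm G a y, shiftedForm_comm G a z]

theorem shiftedForm_smul_right (c : ℝ) (x y : V → ℝ) :
    shiftedForm G a x (c • y) = c * shiftedForm G a x y := by
  rw [shiftedForm_comm, shiftedForm_smul_left, shiftedForm_comm]

theorem shiftedForm_single_self (v : V) :
    shiftedForm G a (Pi.single v 1) (Pi.single v 1) = G.degree v - a := by
  simp [shiftedForm, SimpleGraph.lapMatrix, SimpleGraph.degMatrix]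

theorem shiftedForm_single_of_adj {v w : V} (h : G.Adj v w) :
    shiftedForm G a (Pi.single v 1) (Pi.single w 1) = -1 := by
  simp [shiftedForm, SimpleGraph.lapMatrix, SimpleGraph.degMatrix, h.ne, h]

theorem shiftedForm_single_of_not_adj {v w : V} (h : ¬ G.Adj v w) (hne : v ≠ w) :
    shiftedForm G a (Pi.single v 1) (Pi.single w 1) = 0 := by
  simp [shiftedForm, SimpleGraph.lapMatrix, SimpleGraph.degMatrix, hne, h]

theorem shiftedForm_self (x : V → ℝ) :
    shiftedForm G a x x =
      (∑ i, ∑ j, if G.Adj i j then (x i - x j) ^ 2 else 0) / 2 - a * ∑ i, x i ^ 2 := by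
  rw [shiftedForm, ← toLinearMap₂'_apply', SimpleGraph.lapMatrix_toLinearMap₂']
  simp only [dotProduct, pow_two]

variable {G a}

/-- If `μ₂ ≤ a` then every plane contains a vector at which the form of `L - a` is nonpositive. -/
theorem exists_shiftedForm_nonpos (hV : 2 ≤ Fintype.card V) (ha : laplacianEigenvalue G 2 ≤ a)
    (x y : V → ℝ) : ∃ α β : ℝ, (α ≠ 0 ∨ β ≠ 0) ∧
      shiftedForm G a (α • x + β • y) (α • x + β • y) ≤ 0 := by
  obtain ⟨α, β, h0, h⟩ := exists_rayleigh_le_laplacianEigenvalue_two G hV x y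
  refine ⟨α, β, h0, ?_⟩
  have : 0 ≤ (α • x + β • y) ⬝ᵥ (α • x + β • y) := by
    simpa using dotProduct_star_self_nonneg (α • x + β • y)
  rw [shiftedForm]
  nlinarith [mul_le_mul_of_nonneg_right ha this]

/-- If `μ₂ ≤ a` then `L - a` is positive definite on no plane. -/
theorem shiftedForm_mul_le (hV : 2 ≤ Fintype.card V) (ha : laplacianEigenvalue G 2 ≤ a)
    (x y : V → ℝ) (hx : 0 < shiftedForm G a x x) :
    shiftedForm G a x x * shiftedForm G a y y ≤ shiftedForm G a x y ^ 2 := by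
  obtain ⟨α, β, h0, h1⟩ := exists_shiftedForm_nonpos hV ha x y
  simp only [shiftedForm_add_left, shiftedForm_add_right, shiftedForm_smul_left,
    shiftedForm_smul_right, shiftedForm_comm G a y x] at h1
  set p := shiftedForm G a x x
  set q := shiftedForm G a x y
  set r := shiftedForm G a y y
  by_contra! hlt
  -- This is `p` times the form at `α • x + β • y`, with the square completed.
  have h2 : (α * p + β * q) ^ 2 + β ^ 2 * (p * r - q ^ 2) ≤ 0 := by nlinarith
  have h3 : β = 0 := by
    by_contra hβ
    have : 0 < β ^ 2 * (p * r - q ^ 2) := mul_pos (by positivity) (by linarith)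
    nlinarith [sq_nonneg (α * p + β * q)]
  subst h3
  have h4 : α = 0 := by
    by_contra hα
    have : 0 < α ^ 2 * p := by positivity
    nlinarith
  simp [h4] at h0

/-- Two nonadjacent vertices cannot both have degree exceeding `a ≥ μ₂`. -/
theorem degree_le_of_not_adj (hV : 2 ≤ Fintype.card V) (ha : laplacianEigenvalue G 2 ≤ a)
    {u v : V} (hne : u ≠ v) (h : ¬ G.Adj u v) (hu : a < G.degree u) : (G.degree v : ℝ) ≤ a := by
  have h1 := shiftedForm_mul_le hV ha (Pi.single u 1) (Pi.single v 1)
    (by rw [shiftedForm_single_self]; linarith)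
  rw [shiftedForm_single_self, shiftedForm_single_self, shiftedForm_single_of_not_adj G a h hne]
    at h1
  nlinarith

/-- Edges avoiding a vertex of large degree join vertices of small total degree. -/
theorem degree_add_degree_le (hV : 2 ≤ Fintype.card V) (ha : laplacianEigenvalue G 2 ≤ a)
    {u v w : V} (hv : u ≠ v) (hw : u ≠ w) (h : G.Adj v w) (hu : a < G.degree u) :
    (G.degree u - a) * (G.degree v + G.degree w + 2 - 2 * a) ≤ 1 := by
  have h1 := shiftedForm_mul_le hV ha (Pi.single u 1) (Pi.single v 1 - Pi.single w 1)
    (by rw [shiftedForm_single_self]; linarith)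
  simp only [shiftedForm_sub_left, shiftedForm_sub_right, shiftedForm_single_self,
    shiftedForm_single_of_adj G a h, shiftedForm_single_of_adj G a h.symm] at h1
  -- Each of the two terms is `0` or `-1`.
  have h2 : (shiftedForm G a (Pi.single u 1) (Pi.single v 1) -
      shiftedForm G a (Pi.single u 1) (Pi.single w 1)) ^ 2 ≤ 1 := by
    by_cases hav : G.Adj u v <;> by_cases haw : G.Adj u w <;>
    simp [shiftedForm_single_of_adj, shiftedForm_single_of_not_adj, *]
  refine le_trans (le_of_eq ?_) (h1.trans h2)
  ring

/-- The form is `2` at the difference along any edge, so two such differences must pair to at least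
`2` in absolute value. In a triangle they pair to `-1`. -/
theorem not_adj_of_regular_of_adj (hV : 2 ≤ Fintype.card V) (ha : laplacianEigenvalue G 2 ≤ a)
    (hreg : ∀ v, (G.degree v : ℝ) = a) {u v w : V} (huv : G.Adj u v) (hvw : G.Adj v w) :
    ¬ G.Adj u w := by
  intro huw
  have h1 := shiftedForm_mul_le hV ha (Pi.single u 1 - Pi.single v 1)
    (Pi.single v 1 - Pi.single w 1)
  simp only [shiftedForm_sub_left, shiftedForm_sub_right, shiftedForm_single_self, hreg,
    shiftedForm_single_of_adj G a huv, shiftedForm_single_of_adj G a huv.symm,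
    shiftedForm_single_of_adj G a huw,
    shiftedForm_single_of_adj G a hvw, shiftedForm_single_of_adj G a hvw.symm] at h1
  norm_num at h1

/-- On an induced path the differences along the two end edges pair to `1`, which is again too
small. -/
theorem adj_of_regular_of_path (hV : 2 ≤ Fintype.card V) (ha : laplacianEigenvalue G 2 ≤ a)
    (hreg : ∀ v, (G.degree v : ℝ) = a) {p q r s : V} (hpq : G.Adj p q) (hqr : G.Adj q r)
    (hrs : G.Adj r s) : G.Adj p s := by
  by_contra hps
  have hpr := not_adj_of_regular_of_adj hV ha hreg hpq hqr
  have hqs := not_adj_of_regular_of_adj hV ha hreg hqr hrs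
  have hpr' : p ≠ r := by rintro rfl; exact hps hrs
  have hqs' : q ≠ s := by rintro rfl; exact hps hpq
  have hps' : p ≠ s := by rintro rfl; exact hpr hrs.symm
  have h1 := shiftedForm_mul_le hV ha (Pi.single p 1 - Pi.single q 1)
    (Pi.single r 1 - Pi.single s 1)
  simp only [shiftedForm_sub_left, shiftedForm_sub_right, shiftedForm_single_self, hreg,
    shiftedForm_single_of_adj G a hpq, shiftedForm_single_of_adj G a hpq.symm,
    shiftedForm_single_of_adj G a hqr, shiftedForm_single_of_adj G a hrs,
    shiftedForm_single_of_adj G a hrs.symm, shiftedForm_single_of_not_adj G a hpr hpr',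
    shiftedForm_single_of_not_adj G a hps hps', shiftedForm_single_of_not_adj G a hqs hqs'] at h1
  norm_num at h1

end ShiftedForm

/-! ### Uniqueness of the vertex of large degree -/

section SecondDegree

variable {V : Type*} [Fintype V] [DecidableEq V] {G : SimpleGraph V} [DecidableRel G.Adj] {a : ℝ}

theorem sum_eq_add_add_sum_compl_pair {u v : V} (h : u ≠ v) (g : V → ℝ) :
    ∑ i, g i = g u + g v + ∑ i ∈ ({u, v} : Finset V)ᶜ, g i := by
  rw [← Finset.sum_add_sum_compl {u, v}, Finset.sum_pair h]

/-- Bounds the Dirichlet energy below by discarding the edges that avoid both `u` and `v`. -/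
theorem add_sum_le_half_sum_sum {u v : V} (h : u ≠ v) (f : V → V → ℝ) (hf : ∀ i j, 0 ≤ f i j)
    (hs : ∀ i j, f i j = f j i) :
    f u v + ∑ z ∈ ({u, v} : Finset V)ᶜ, (f u z + f v z) ≤ (∑ i, ∑ j, f i j) / 2 := by
  have h3 : ∑ z ∈ ({u, v} : Finset V)ᶜ, (f u z + f v z) ≤
      ∑ i ∈ ({u, v} : Finset V)ᶜ, ∑ j, f i j := by
    refine Finset.sum_le_sum fun z _ => ?_
    rw [sum_eq_add_add_sum_compl_pair h, hs u z, hs v z]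
    linarith [Finset.sum_nonneg fun i (_ : i ∈ ({u, v} : Finset V)ᶜ) => hf z i]
  rw [sum_eq_add_add_sum_compl_pair h, sum_eq_add_add_sum_compl_pair h (f u),
    sum_eq_add_add_sum_compl_pair h (f v), hs v u]
  rw [Finset.sum_add_distrib] at *
  linarith [hf u u, hf v v]

/-- The contribution of one further vertex to the Dirichlet energy of the test vector of
`degree_le_of_adj`. -/
theorem star_energy_identity (t d α β p q : ℝ) (ht : t * (d - 1) = 1) (hp : p = 0 ∨ p = 1)
    (hq : q = 0 ∨ q = 1) :
    p * (α + t * (α * p + β * q)) ^ 2 + q * (β + t * (α * p + β * q)) ^ 2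
      - d * (t * (α * p + β * q)) ^ 2 =
    (1 + t) * α ^ 2 * p + (1 + t) * β ^ 2 * q
      + (t ^ 2 * (α + β) ^ 2 + 2 * t * α * β) * (p * q) := by
  have hd : d * t ^ 2 = t + t ^ 2 := by linear_combination t * ht
  rcases hp with rfl | rfl <;> rcases hq with rfl | rfl
  · ring
  · linear_combination -β ^ 2 * hd
  · linear_combination -α ^ 2 * hd
  · linear_combination -(α + β) ^ 2 * hd

/-- If `a < d = deg v`, the form of `L - a` would be positive on a plane spanned by two star-shaped
vectors, centred at `u` and `v`: their Rayleigh quotients are at least `d`, even when the stars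
overlap. -/
theorem degree_le_of_adj_of_degree_le (hV : 2 ≤ Fintype.card V)
    (ha : laplacianEigenvalue G 2 ≤ a) (ha1 : 1 ≤ a)
    {u v : V} (huv : G.Adj u v) (hle : G.degree v ≤ G.degree u) : (G.degree v : ℝ) ≤ a := by
  by_contra! hlt
  set d : ℝ := (G.degree v : ℝ)
  set D : ℝ := (G.degree u : ℝ)
  have hdD : d ≤ D := Nat.cast_le.2 hle
  have hd1 : 0 < d - 1 := by linarith
  -- Value `1` at the centre and `-t` at the leaves is the eigenvector of `K_{1,d-1}` for the
  -- eigenvalue `d`.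
  set t : ℝ := 1 / (d - 1) with ht
  have ht0 : 0 < t := by positivity
  have ht1 : t * (d - 1) = 1 := by rw [ht]; field_simp
  have hne := huv.ne
  set p : V → ℝ := fun z => if G.Adj u z then 1 else 0 with hp
  set q : V → ℝ := fun z => if G.Adj v z then 1 else 0 with hq
  have hp01 : ∀ z, p z = 0 ∨ p z = 1 := fun z => by simp only [hp]; split_ifs <;> simp
  have hq01 : ∀ z, q z = 0 ∨ q z = 1 := fun z => by simp only [hq]; split_ifs <;> simp
  set S : Finset V := ({u, v} : Finset V)ᶜ with hS
  have hS' : ∀ z ∈ S, z ≠ u ∧ z ≠ v := fun z hz => by simpa [hS] using hz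
  have hsp : ∑ z ∈ S, p z = D - 1 := by
    have h := sum_eq_add_add_sum_compl_pair hne p
    have h' := G.degree_eq_sum_if_adj (R := ℝ) u
    rw [← h'] at h
    simp only [hp, huv, G.irrefl, if_true, if_false] at h
    linarith
  have hsq : ∑ z ∈ S, q z = d - 1 := by
    have h := sum_eq_add_add_sum_compl_pair hne q
    have h' := G.degree_eq_sum_if_adj (R := ℝ) v
    rw [← h'] at h
    simp only [hq, huv.symm, G.irrefl, if_true, if_false] at h
    linarith
  have hc0 : 0 ≤ ∑ z ∈ S, p z * q z := Finset.sum_nonneg fun z _ => by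
    rcases hp01 z with h | h <;> rcases hq01 z with h' | h' <;> simp [h, h']
  have hcd : ∑ z ∈ S, p z * q z ≤ d - 1 := by
    rw [← hsq]
    refine Finset.sum_le_sum fun z _ => ?_
    rcases hp01 z with h | h <;> rcases hq01 z with h' | h' <;> simp [h, h']
  obtain ⟨α, β, h0, h⟩ := exists_shiftedForm_nonpos hV ha
    (fun z => if z = u then 1 else if z = v then 0 else -t * p z)
    (fun z => if z = u then 0 else if z = v then 1 else -t * q z)
  set x : V → ℝ := α • (fun z => if z = u then 1 else if z = v then 0 else -t * p z) +
    β • (fun z => if z = u then 0 else if z = v then 1 else -t * q z) with hx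
  have hxu : x u = α := by simp [hx]
  have hxv : x v = β := by simp [hx, hne.symm]
  have hxz : ∀ z ∈ S, x z = -(t * (α * p z + β * q z)) := fun z hz => by
    simp only [hx, Pi.add_apply, Pi.smul_apply, smul_eq_mul, if_neg (hS' z hz).1,
      if_neg (hS' z hz).2]
    ring
  rw [shiftedForm_self] at h
  have hE := add_sum_le_half_sum_sum hne (fun i j => if G.Adj i j then (x i - x j) ^ 2 else 0)
    (fun i j => by split_ifs <;> positivity)
    (fun i j => by simp only [G.adj_comm i j]; split_ifs <;> ring)
  have hN := sum_eq_add_add_sum_compl_pair hne (fun z => x z ^ 2)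
  have hE2 : ∑ z ∈ S, ((if G.Adj u z then (x u - x z) ^ 2 else 0) +
      (if G.Adj v z then (x v - x z) ^ 2 else 0)) - d * ∑ z ∈ S, x z ^ 2 =
      (1 + t) * α ^ 2 * (D - 1) + (1 + t) * β ^ 2 * (d - 1) +
      (t ^ 2 * (α + β) ^ 2 + 2 * t * α * β) * ∑ z ∈ S, p z * q z := by
    rw [← hsp, ← hsq, Finset.mul_sum, Finset.mul_sum, Finset.mul_sum, Finset.mul_sum,
      ← Finset.sum_sub_distrib, ← Finset.sum_add_distrib, ← Finset.sum_add_distrib]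
    refine Finset.sum_congr rfl fun z hz => ?_
    rw [← star_energy_identity t d α β (p z) (q z) ht1 (hp01 z) (hq01 z), hxz z hz, hxu, hxv]
    simp only [hp, hq]
    split_ifs <;> ring
  simp only [huv, if_true, hxu, hxv] at hE hN hE2
  set c := ∑ z ∈ S, p z * q z with hc
  have hct0 : 0 ≤ c * t := by positivity
  have hct1 : c * t ≤ 1 := by nlinarith
  have hN0 : 0 < ∑ z, x z ^ 2 := by
    have h1 : 0 ≤ ∑ z ∈ S, x z ^ 2 := Finset.sum_nonneg fun z _ => sq_nonneg _
    have h2 : 0 < α ^ 2 + β ^ 2 := by rcases h0 with h0 | h0 <;> positivity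
    linarith
  have h1 : (1 + t) * β ^ 2 * (d - 1) = d * β ^ 2 := by linear_combination β ^ 2 * ht1
  have h2 : d * α ^ 2 ≤ (1 + t) * α ^ 2 * (D - 1) := by
    have h3 : (1 + t) * α ^ 2 * (d - 1) = d * α ^ 2 := by linear_combination α ^ 2 * ht1
    rw [← h3]
    gcongr
  -- The energy of the edge `uv` absorbs the cross term from the `c ≤ d - 1` common neighbours.
  have h4 : 0 ≤ (α - β) ^ 2 + (t ^ 2 * (α + β) ^ 2 + 2 * t * α * β) * c := by
    have h5 : (α - β) ^ 2 + (t ^ 2 * (α + β) ^ 2 + 2 * t * α * β) * c =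
      (1 - c * t) * (α - β) ^ 2 + c * t * (α ^ 2 + β ^ 2) + c * (t ^ 2 * (α + β) ^ 2) := by ring
    rw [h5]
    have : 0 ≤ 1 - c * t := by linarith
    positivity
  have h6 := mul_pos (sub_pos.2 hlt) hN0
  rw [hN] at h h6
  linarith

/-- If `a ≥ μ₂`, only one vertex can have degree exceeding `a`. -/
theorem degree_le_of_ne (hV : 2 ≤ Fintype.card V) (ha : laplacianEigenvalue G 2 ≤ a)
    (ha1 : 1 ≤ a) {u v : V} (hne : u ≠ v) (hu : a < G.degree u) : (G.degree v : ℝ) ≤ a := by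
  by_cases h : G.Adj u v
  · rcases le_total (G.degree v) (G.degree u) with hle | hle
    · exact degree_le_of_adj_of_degree_le hV ha ha1 h hle
    · exact absurd (degree_le_of_adj_of_degree_le hV ha ha1 h.symm hle) (not_le.2 hu)
  · exact degree_le_of_not_adj hV ha hne h hu

end SecondDegree

/-! ### Double counting against the edge bound -/

section Counting

/-- Violates the edge bound for an edge joining two vertices of degree `k`. For `s > 0` it rests on
`s (n - s) ≥ n - 1`. -/
theorem sq_lt_mul_of_pos {n s J : ℤ} (hn : 4 ≤ n) (hs : 0 ≤ s) (hsn : s < n) (hJ : 0 ≤ J)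
    (hpos : 0 < (n - 1) * s + n * J) : n ^ 2 < ((n - 1) * s + n * J) * (2 * n - 2 * s) := by
  rcases hs.eq_or_lt with rfl | hs0
  · have hJ1 : 1 ≤ J := by
      by_contra hJ0
      have : J = 0 := by omega
      simp [this] at hpos
    have h1 : n * n ≤ n * n * J := le_mul_of_one_le_right (by positivity) hJ1
    nlinarith
  · have h1 : n - 1 ≤ s * (n - s) := by nlinarith
    have h2 : 0 ≤ n * J * (n - s) :=
      mul_nonneg (mul_nonneg (by linarith) hJ) (by linarith)
    have h3 := mul_le_mul_of_nonneg_left h1 (by linarith : (0 : ℤ) ≤ n - 1)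
    have h4 : ((n - 1) * s + n * J) * (2 * n - 2 * s) =
      2 * ((n - 1) * (s * (n - s))) + 2 * (n * J * (n - s)) := by ring
    rw [h4]
    nlinarith

/-- Violates the edge bound for an edge joining degree `k` to degree `k - j`, `j ≤ 1`. -/
theorem sq_lt_mul_of_le {n s J j : ℤ} (hs : 0 ≤ s) (hsn : 2 * s + 5 ≤ n) (hJ : 2 + s ≤ J)
    (hj : j ≤ 1) : n ^ 2 < ((n - 1) * s + n * J) * (n * (2 - j) - 2 * s) := by
  have hn : 0 < n := by linarith
  have h1 : n - 2 * s ≤ n * (2 - j) - 2 * s := by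
    have : n * 1 ≤ n * (2 - j) := mul_le_mul_of_nonneg_left (by linarith) hn.le
    linarith
  have h2 : n * (2 + s) ≤ (n - 1) * s + n * J := by
    have h3 : n * (2 + s) ≤ n * J := mul_le_mul_of_nonneg_left hJ hn.le
    have h4 : 0 ≤ (n - 1) * s := mul_nonneg (by linarith) hs
    linarith
  have h3 := mul_le_mul h2 h1 (by linarith) (le_trans (by positivity) h2)
  have h4 : n < (2 + s) * (n - 2 * s) := by
    have : 0 ≤ s * (n - 4 - 2 * s) := mul_nonneg hs (by linarith)
    nlinarith
  have h5 := mul_lt_mul_of_pos_left h4 hn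
  nlinarith

variable {V : Type*} [Fintype V] [DecidableEq V] {G : SimpleGraph V} [DecidableRel G.Adj]

/-- Double counting of the edges between `F` and `T`. -/
theorem false_of_neighbors_subset {u : V} {k : ℕ} (hk : 2 ≤ k) (F T : Finset V)
    (hcard : T.card < F.card) (hF : ∀ v ∈ F, G.degree v = k)
    (hT : ∀ w ∈ T, G.degree w ≤ k - 1)
    (hN : ∀ v ∈ F, ∀ w, G.Adj v w → w ≠ u → w ∈ T) : False := by
  -- Each vertex of `F` sends at least `k - 1` edges into `T`, and each vertex of `T` receives at
  -- most `k - 1`.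
  have h := Finset.card_mul_le_card_mul (s := F) (t := T) (m := k - 1) (n := k - 1) G.Adj
    (fun v hv => ?_) (fun w hw => ?_)
  · have := Nat.le_of_mul_le_mul_right h (by omega)
    omega
  · have hsub : (G.neighborFinset v).erase u ⊆ Finset.bipartiteAbove G.Adj T v := fun w hw => by
      rw [Finset.mem_erase, SimpleGraph.mem_neighborFinset] at hw
      rw [Finset.mem_bipartiteAbove]
      exact ⟨hN v hv w hw.2 hw.1, hw.2⟩
    have h1 := Finset.card_le_card hsub
    have h2 := Finset.pred_card_le_card_erase (s := G.neighborFinset v) (a := u)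
    rw [SimpleGraph.card_neighborFinset_eq_degree, hF v hv] at h2
    omega
  · refine le_trans (Finset.card_le_card fun v hv => ?_) (hT w hw)
    rw [Finset.mem_bipartiteBelow] at hv
    simpa using hv.2.symm

/-- Let `J` be the total deficiency below `k` away from `u`; then `deg u = k + s + J < n`. Full
vertices `F` have neighbours other than `u` only among the deficient ones `W`, which is impossible
if `|W| < |F|`. If `|W| ≥ |F|`, then `J` is large and `s` small, so these neighbours have deficiency
at least `2`; but `|W| + |Z| ≤ J` makes the set `Z` of such vertices smaller than `F`. -/
theorem false_of_edge_bound {u : V} {n k s : ℕ} (hn : Fintype.card V = n) (hk : 2 ≤ k)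
    (hs : s < n) (hsum : ∑ v, G.degree v = n * k + s)
    (hdeg : ∀ v, v ≠ u → G.degree v ≤ k) (hD : n * k + s < n * G.degree u)
    (hedge : ∀ v w, u ≠ v → u ≠ w → G.Adj v w →
      ((n : ℤ) * G.degree u - (n * k + s)) *
        (n * (G.degree v + G.degree w + 2) - 2 * (n * k + s)) ≤ n ^ 2) : False := by
  set R := Finset.univ.erase u with hR
  have hRc : R.card + 1 = n := by
    rw [hR, Finset.card_erase_add_one (Finset.mem_univ u), Finset.card_univ, hn]
  have hmem : ∀ v, v ∈ R ↔ v ≠ u := fun v => by simp [hR]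
  set J := ∑ v ∈ R, (k - G.degree v) with hJ
  have hJsum : ∑ v ∈ R, G.degree v + J = R.card * k := by
    rw [hJ, ← Finset.sum_add_distrib, ← smul_eq_mul, ← Finset.sum_const]
    refine Finset.sum_congr rfl fun v hv => ?_
    have := hdeg v ((hmem v).1 hv)
    omega
  have hD' : G.degree u = k + s + J := by
    rw [← Finset.add_sum_erase _ _ (Finset.mem_univ u), ← hR, ← hRc] at hsum
    nlinarith
  have hDn : G.degree u < n := hn ▸ G.degree_lt_card_verts u
  set F := R.filter fun v => G.degree v = k with hF
  set W := R.filter fun v => ¬ G.degree v = k with hW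
  set Z := R.filter fun v => G.degree v + 2 ≤ k with hZ
  have hFW : F.card + W.card = R.card := Finset.card_filter_add_card_filter_not _
  have hJWZ : W.card + Z.card ≤ J := by
    rw [hW, hZ, Finset.card_filter, Finset.card_filter, ← Finset.sum_add_distrib]
    refine Finset.sum_le_sum fun v hv => ?_
    have := hdeg v ((hmem v).1 hv)
    split_ifs <;> omega
  have hpos : (n : ℤ) * (k + s + J) - (n * k + s) = (n - 1) * s + n * J := by ring
  have hpos' : 0 < (n - 1 : ℤ) * s + n * J := by
    rw [← hpos]
    rw [hD'] at hD
    zify at hD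
    linarith
  have hF' : ∀ v ∈ F, u ≠ v ∧ G.degree v = k := fun v hv => by
    rw [hF, Finset.mem_filter, hmem] at hv
    exact ⟨hv.1.symm, hv.2⟩
  have hedge' : ∀ v ∈ F, ∀ w, G.Adj v w → w ≠ u → ∀ j : ℤ, (G.degree w : ℤ) = k - j →
      ((n - 1 : ℤ) * s + n * J) * (n * (2 - j) - 2 * s) ≤ n ^ 2 := fun v hv w hvw hw j hj => by
    have h := hedge v w (hF' v hv).1 hw.symm hvw
    rw [hD', (hF' v hv).2, hj] at h
    push_cast at h
    rw [hpos] at h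
    refine le_trans (le_of_eq ?_) h
    ring
  by_cases hWF : W.card < F.card
  · refine false_of_neighbors_subset (u := u) hk F W hWF (fun v hv => (hF' v hv).2) (fun w hw => ?_)
      fun v hv w hvw hwu => ?_
    · rw [hW, Finset.mem_filter, hmem] at hw
      have := hdeg w hw.1
      omega
    · rw [hW, Finset.mem_filter, hmem]
      refine ⟨hwu, fun hwk => ?_⟩
      have h := hedge' v hv w hvw hwu 0 (by rw [hwk]; ring)
      have hn4 : (4 : ℤ) ≤ n := by
        rcases Nat.eq_zero_or_pos s with h0 | h0
        · subst h0
          have : 0 < J := by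
            by_contra hJ0
            have : J = 0 := by omega
            simp [this] at hpos'
          omega
        · omega
      have hJ0 : (0 : ℤ) ≤ J := by positivity
      refine absurd h (not_le.2 ?_)
      refine (sq_lt_mul_of_pos hn4 (by positivity) (by exact_mod_cast hs) hJ0 hpos').trans_eq ?_
      ring
  · refine false_of_neighbors_subset (u := u) hk F Z (by omega) (fun v hv => (hF' v hv).2) (fun w hw => ?_)
      fun v hv w hvw hwu => ?_
    · rw [hZ, Finset.mem_filter, hmem] at hw
      omega
    · rw [hZ, Finset.mem_filter, hmem]
      refine ⟨hwu, ?_⟩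
      by_contra hwk
      have hwk' := hdeg w hwu
      have h2s : 2 * (s : ℤ) + 5 ≤ n := by omega
      have hJs : (2 : ℤ) + s ≤ J := by omega
      have h := hedge' v hv w hvw hwu (k - G.degree w) (by ring)
      have hj : (k : ℤ) - G.degree w ≤ 1 := by omega
      exact absurd h (not_le.2 (sq_lt_mul_of_le (by positivity) h2s hJs hj))

end Counting

/-! ### Complete bipartite graphs and `μ₂` of `K_{h,h}` -/

section CompleteBipartite

theorem nonempty_iso_completeBipartiteGraph {V : Type*} [Fintype V]
    {G : SimpleGraph V} (p : V → Prop) [DecidablePred p] {a b : ℕ}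
    (ha : Fintype.card {v // p v} = a) (hb : Fintype.card {v // ¬ p v} = b)
    (h : ∀ v w, G.Adj v w ↔ (p v ∧ ¬ p w ∨ ¬ p v ∧ p w)) :
    Nonempty (G ≃g completeBipartiteGraph (Fin a) (Fin b)) := by
  let e : V ≃ Fin a ⊕ Fin b := (Equiv.sumCompl p).symm.trans
    ((Fintype.equivFinOfCardEq ha).sumCongr (Fintype.equivFinOfCardEq hb))
  have hl : ∀ v, (e v).isLeft = true ↔ p v := fun v => by
    by_cases hv : p v <;> simp [e, hv, Equiv.sumCompl_symm_apply_of_pos,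
      Equiv.sumCompl_symm_apply_of_neg]
  have hr : ∀ v, (e v).isRight = true ↔ ¬ p v := fun v => by
    rw [← hl v]
    cases e v <;> simp
  exact ⟨⟨e, fun {v w} => by rw [completeBipartiteGraph_adj, h, hl, hl, hr, hr]⟩⟩

theorem sum_eq_sum_add_sum_of_iso {V : Type*} [Fintype V] {G : SimpleGraph V} {h : ℕ}
    (φ : G ≃g completeBipartiteGraph (Fin h) (Fin h)) (f : V → ℝ) :
    ∑ v, f v = ∑ i, f (φ.symm (Sum.inl i)) + ∑ i, f (φ.symm (Sum.inr i)) := by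
  rw [← φ.symm.toEquiv.sum_comp, Fintype.sum_sum_type]
  rfl

variable {V : Type*} [Fintype V] [DecidableEq V] {G : SimpleGraph V} [DecidableRel G.Adj]

theorem two_mul_card_edgeFinset_of_iso {V : Type*} [Fintype V] {G : SimpleGraph V}
    [DecidableRel G.Adj] {h : ℕ}
    (φ : G ≃g completeBipartiteGraph (Fin h) (Fin h)) :
    (2 * G.edgeFinset.card : ℝ) = 2 * (h * h) := by
  have h1 : (2 * G.edgeFinset.card : ℝ) = ∑ v, (G.degree v : ℝ) := by
    exact_mod_cast G.sum_degrees_eq_twice_card_edges.symm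
  rw [h1]
  simp only [G.degree_eq_sum_if_adj, sum_eq_sum_add_sum_of_iso φ, φ.symm.map_adj_iff,
    completeBipartiteGraph_adj, Sum.isLeft_inl, Sum.isRight_inl, Sum.isLeft_inr, Sum.isRight_inr]
  simp
  ring

theorem shiftedForm_self_of_iso {h : ℕ}
    (φ : G ≃g completeBipartiteGraph (Fin h) (Fin h)) (x : V → ℝ) :
    shiftedForm G h x x =
      -2 * (∑ i, x (φ.symm (Sum.inl i))) * ∑ i, x (φ.symm (Sum.inr i)) := by
  rw [shiftedForm_self]
  simp only [sum_eq_sum_add_sum_of_iso φ, φ.symm.map_adj_iff, completeBipartiteGraph_adj,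
    Sum.isLeft_inl, Sum.isRight_inl, Sum.isLeft_inr, Sum.isRight_inr]
  simp [sub_sq, Finset.sum_add_distrib, Finset.sum_sub_distrib, ← Finset.mul_sum,
    ← Finset.sum_mul]
  ring

theorem laplacianEigenvalue_two_of_iso {h : ℕ} (hh : 2 ≤ h)
    (φ : G ≃g completeBipartiteGraph (Fin h) (Fin h)) : laplacianEigenvalue G 2 = h := by
  have hV : 2 ≤ Fintype.card V := by
    rw [Fintype.card_congr φ.toEquiv, Fintype.card_sum, Fintype.card_fin]
    omega
  have hsub : ∀ (a : ℝ) (x : V → ℝ),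
      shiftedForm G a x x = shiftedForm G h x x + (h - a) * ∑ v, x v ^ 2 := fun a x => by
    rw [shiftedForm_self, shiftedForm_self]
    ring
  -- The eigenvector for the top eigenvalue `2h`; orthogonality to it equates the sums over the two
  -- sides.
  set w : V → ℝ := fun v => if (φ v).isLeft then 1 else -1 with hw
  apply le_antisymm
  · refine laplacianEigenvalue_two_le_of_orthogonal G hV w h fun x hx => ?_
    have h1 := shiftedForm_self_of_iso φ x
    rw [dotProduct, sum_eq_sum_add_sum_of_iso φ] at hx
    simp only [hw, RelIso.apply_symm_apply, Sum.isLeft_inl, Sum.isLeft_inr, if_true, one_mul,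
      Bool.false_eq_true, if_false, neg_mul, Finset.sum_neg_distrib] at hx
    have h2 : ∑ i, x (φ.symm (Sum.inl i)) = ∑ i, x (φ.symm (Sum.inr i)) := by linarith
    rw [h2, shiftedForm] at h1
    nlinarith [sq_nonneg (∑ i, x (φ.symm (Sum.inr i)))]
  · by_contra! hlt
    let i₀ : Fin h := ⟨0, by omega⟩
    let i₁ : Fin h := ⟨1, by omega⟩
    have hi : i₀ ≠ i₁ := by simp [i₀, i₁]
    -- The form of `L - h` is nonnegative on this plane, so `μ₂ < h` would force a nontrivial
    -- combination to vanish.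
    obtain ⟨α, β, h0, hq⟩ := exists_shiftedForm_nonpos (G := G) hV le_rfl
      (Pi.single (φ.symm (Sum.inl i₀)) 1 - Pi.single (φ.symm (Sum.inl i₁)) 1) w
    set z : V → ℝ := α • (Pi.single (φ.symm (Sum.inl i₀)) 1 -
      Pi.single (φ.symm (Sum.inl i₁)) 1) + β • w with hz
    have hzl : ∀ i, z (φ.symm (Sum.inl i)) =
        α * ((if i = i₀ then 1 else 0) - if i = i₁ then 1 else 0) + β := fun i => by
      simp [hz, hw, Pi.single_apply]
    have hzr : ∀ i, z (φ.symm (Sum.inr i)) = -β := fun i => by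
      simp [hz, hw]
    rw [hsub, shiftedForm_self_of_iso φ z] at hq
    have hsl : ∑ i, z (φ.symm (Sum.inl i)) = h * β := by
      simp only [hzl, Finset.sum_add_distrib, ← Finset.mul_sum, Finset.sum_sub_distrib,
        Finset.sum_ite_eq', Finset.mem_univ, if_true]
      simp
    have hsr : ∑ i, z (φ.symm (Sum.inr i)) = -(h * β) := by simp [hzr]
    rw [hsl, hsr] at hq
    have h1 : ∑ v, z v ^ 2 ≤ 0 := by
      by_contra! hpos
      nlinarith [mul_pos (sub_pos.2 hlt) hpos, sq_nonneg ((h : ℝ) * β)]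
    have h2 : ∀ v, z v = 0 := fun v => by
      have h3 : z v ^ 2 ≤ ∑ v, z v ^ 2 :=
        Finset.single_le_sum (f := fun v => z v ^ 2) (fun _ _ => sq_nonneg _) (Finset.mem_univ v)
      have h4 : z v ^ 2 = 0 := le_antisymm (h3.trans h1) (sq_nonneg _)
      simpa using h4
    have h3 := hzr i₀
    have h4 := hzl i₀
    rw [h2] at h3 h4
    have hβ : β = 0 := by linarith
    have hα : α = 0 := by
      rw [if_pos rfl, if_neg hi] at h4
      linarith
    simp [hα, hβ] at h0

end CompleteBipartite

/-! ### Regular graphs, stars and the main theorem -/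

section Main

variable {V : Type*} [Fintype V] [DecidableEq V] {G : SimpleGraph V} [DecidableRel G.Adj] {a : ℝ}

/-- A connected regular graph of degree at least `μ₂` is balanced complete bipartite. -/
theorem exists_iso_of_regular (hV : 2 ≤ Fintype.card V) (hconn : G.Connected)
    (ha : laplacianEigenvalue G 2 ≤ a) (hreg : ∀ v, (G.degree v : ℝ) = a) :
    Even (Fintype.card V) ∧ Nonempty (G ≃g completeBipartiteGraph (Fin (Fintype.card V / 2))
      (Fin (Fintype.card V / 2))) := by
  have hnt : Nontrivial V := Fintype.one_lt_card_iff_nontrivial.1 hV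
  obtain ⟨x⟩ := hconn.nonempty
  obtain ⟨y, hxy⟩ := hconn.preconnected.exists_adj_of_nontrivial x
  have hpath {p q r s : V} := adj_of_regular_of_path hV ha hreg (p := p) (q := q) (r := r) (s := s)
  have htri {p q r : V} := not_adj_of_regular_of_adj hV ha hreg (u := p) (v := q) (w := r)
  -- Along a walk from `y`, closing paths of three edges switches between adjacency to `x` and to
  -- `y`.
  have hcover : ∀ v, G.Adj x v ∨ G.Adj y v := by
    intro v
    have hreach := hconn.preconnected y v
    induction SimpleGraph.reachable_iff_reflTransGen _ _ |>.1 hreach with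
    | refl => exact Or.inl hxy
    | tail _ hbc ih =>
      rcases ih (SimpleGraph.reachable_iff_reflTransGen _ _ |>.2 ‹_›) with h | h
      · exact Or.inr (hpath hxy.symm h hbc)
      · exact Or.inl (hpath hxy h hbc)
  have hnot : ∀ v, ¬ G.Adj x v ↔ G.Adj y v := fun v =>
    ⟨fun h => (hcover v).resolve_left h, fun h => htri hxy h⟩
  have hadj : ∀ v w, G.Adj v w ↔
      (G.Adj x v ∧ ¬ G.Adj x w ∨ ¬ G.Adj x v ∧ G.Adj x w) := by
    intro v w
    simp only [hnot]
    constructor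
    · intro h
      rcases hcover v with hv | hv
      · exact Or.inl ⟨hv, (hnot w).1 (htri hv h)⟩
      · refine Or.inr ⟨hv, (hcover w).resolve_right (htri hv h)⟩
    · rintro (⟨hv, hw⟩ | ⟨hv, hw⟩)
      · exact hpath hv.symm hxy hw
      · exact hpath hv.symm hxy.symm hw
  have hcx : Fintype.card {v // G.Adj x v} = G.degree x := by
    rw [Fintype.card_subtype, ← G.card_neighborFinset_eq_degree, G.neighborFinset_eq_filter]
  have hcy : Fintype.card {v // ¬ G.Adj x v} = G.degree x := by
    have h : G.degree x = G.degree y := by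
      have := (hreg x).trans (hreg y).symm
      exact_mod_cast this
    rw [h, Fintype.card_subtype, ← G.card_neighborFinset_eq_degree, G.neighborFinset_eq_filter]
    simp only [hnot]
  have hn : Fintype.card V = G.degree x + G.degree x := by
    rw [← Fintype.card_congr (Equiv.sumCompl (G.Adj x)), Fintype.card_sum, hcx, hcy]
  have hn2 : Fintype.card V / 2 = G.degree x := by omega
  rw [hn2]
  exact ⟨⟨_, hn⟩, nonempty_iso_completeBipartiteGraph (G.Adj x) hcx hcy hadj⟩

/-- A connected graph all of whose vertices but one have degree at most one is a star. -/
theorem nonempty_iso_star {u : V} (hconn : G.Connected) (hdeg : ∀ v, v ≠ u → G.degree v ≤ 1) :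
    Nonempty (G ≃g completeBipartiteGraph (Fin 1) (Fin (Fintype.card V - 1))) := by
  have hm := hconn.card_vert_le_card_edgeSet_add_one
  have hsum := G.sum_degrees_eq_twice_card_edges
  rw [Nat.card_eq_fintype_card, Nat.card_eq_fintype_card, ← SimpleGraph.edgeFinset_card] at hm
  have hc := Finset.card_erase_add_one (Finset.mem_univ u)
  rw [Finset.card_univ] at hc
  rw [← Finset.add_sum_erase _ _ (Finset.mem_univ u)] at hsum
  have h1 : ∑ v ∈ Finset.univ.erase u, G.degree v ≤ (Finset.univ.erase u).card * 1 := by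
    rw [← smul_eq_mul]
    exact Finset.sum_le_card_nsmul _ _ _ fun v hv => hdeg v (Finset.ne_of_mem_erase hv)
  -- As `m ≥ n - 1` and the other degrees sum to at most `n - 1`, `u` has degree at least `n - 1`.
  have hN : G.neighborFinset u = Finset.univ.erase u := by
    refine Finset.eq_of_subset_of_card_le (fun v hv => ?_) ?_
    · rw [SimpleGraph.mem_neighborFinset] at hv
      simp [hv.ne']
    · rw [G.card_neighborFinset_eq_degree]
      omega
  have hu : ∀ v, v ≠ u → G.Adj u v := fun v hv => by
    rw [← SimpleGraph.mem_neighborFinset, hN]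
    simp [hv]
  refine nonempty_iso_completeBipartiteGraph (· = u) (by simp) ?_ fun v w => ?_
  · rw [Fintype.card_subtype_compl]
    simp
  · constructor
    · intro h
      by_cases hv : v = u
      · exact Or.inl ⟨hv, fun hw => h.ne (hv.trans hw.symm)⟩
      · refine Or.inr ⟨hv, ?_⟩
        have h2 : (G.neighborFinset v).card ≤ 1 := by
          rw [G.card_neighborFinset_eq_degree]
          exact hdeg v hv
        exact Finset.card_le_one.1 h2 w (by simpa using h) u (by simpa using (hu v hv).symm)
    · rintro (⟨rfl, hw⟩ | ⟨hv, rfl⟩)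
      · exact hu w hw
      · exact (hu v hv).symm

/-- A connected graph, not a star, with `μ₂` at most the average degree is balanced complete
bipartite. -/
theorem exists_iso_of_laplacianEigenvalue_two_le (hconn : G.Connected)
    (hstar : ¬ Nonempty (G ≃g completeBipartiteGraph (Fin 1) (Fin (Fintype.card V - 1))))
    (hV : 2 ≤ Fintype.card V)
    (hμ : laplacianEigenvalue G 2 ≤ 2 * G.edgeFinset.card / Fintype.card V) :
    Even (Fintype.card V) ∧ Nonempty (G ≃g completeBipartiteGraph (Fin (Fintype.card V / 2))
      (Fin (Fintype.card V / 2))) := by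
  set n := Fintype.card V with hn
  set M := 2 * G.edgeFinset.card with hM
  set a : ℝ := 2 * G.edgeFinset.card / n with ha
  have hn0 : (0 : ℝ) < n := by positivity
  have hna : n * a = M := by
    rw [ha, hM]
    push_cast
    field_simp
  have hsum : ∑ v, G.degree v = M := G.sum_degrees_eq_twice_card_edges
  have hm := hconn.card_vert_le_card_edgeSet_add_one
  rw [Nat.card_eq_fintype_card, Nat.card_eq_fintype_card, ← SimpleGraph.edgeFinset_card] at hm
  have ha1 : 1 ≤ a := by
    have h1 : (n : ℝ) * 1 ≤ n * a := by
      rw [hna, mul_one]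
      exact_mod_cast (by omega : n ≤ M)
    exact le_of_mul_le_mul_left h1 hn0
  by_cases hex : ∃ u, a < G.degree u
  · exfalso
    obtain ⟨u, hu⟩ := hex
    have hdm := Nat.div_add_mod M n
    have hs := Nat.mod_lt M (by omega : 0 < n)
    have hdeg : ∀ v, v ≠ u → G.degree v ≤ M / n := fun v hv => by
      have h1 := degree_le_of_ne hV hμ ha1 hv.symm hu
      rw [Nat.le_div_iff_mul_le (by omega)]
      have h2 : (G.degree v : ℝ) * n ≤ M := by
        rw [← hna, mul_comm]
        exact mul_le_mul_of_nonneg_left h1 hn0.le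
      exact_mod_cast h2
    have hk : 2 ≤ M / n := by
      by_contra hk
      exact hstar (nonempty_iso_star hconn fun v hv => (hdeg v hv).trans (by omega))
    refine false_of_edge_bound hn.symm hk hs (by rw [hsum, hdm]) hdeg ?_ ?_
    · rw [hdm]
      have h1 : (M : ℝ) < n * G.degree u := by
        rw [← hna]
        exact mul_lt_mul_of_pos_left hu hn0
      exact_mod_cast h1
    · intro v w hv hw hvw
      have h1 := degree_add_degree_le hV hμ hv hw hvw hu
      have h2 := mul_le_mul_of_nonneg_left h1 (sq_nonneg (n : ℝ))
      have h3 : (n : ℝ) ^ 2 * ((G.degree u - a) * (G.degree v + G.degree w + 2 - 2 * a)) =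
          (n * G.degree u - M) * (n * (G.degree v + G.degree w + 2) - 2 * M) := by
        rw [← hna]
        ring
      rw [h3, mul_one] at h2
      have h4 : (n : ℤ) * (M / n : ℕ) + (M % n : ℕ) = M := by exact_mod_cast hdm
      rw [h4]
      exact_mod_cast h2
  -- No degree exceeds the average, so all equal it.
  · push Not at hex
    refine exists_iso_of_regular hV hconn hμ fun v => ?_
    have h1 : ∑ v, (G.degree v : ℝ) = ∑ _v : V, a := by
      rw [Finset.sum_const, Finset.card_univ, nsmul_eq_mul, ← hn, hna]
      exact_mod_cast hsum
    exact (Finset.sum_eq_sum_iff_of_le fun v _ => hex v).1 h1 v (Finset.mem_univ v)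

end Main

theorem theorem3p4 {V : Type*} [Fintype V] [DecidableEq V]
    (G : SimpleGraph V) [DecidableRel G.Adj] (n m : ℕ)
    (hn : Fintype.card V = n) (hm : G.edgeFinset.card = m)
    (hconn : G.Connected)
    (hstar : ¬ Nonempty (G ≃g completeBipartiteGraph (Fin 1) (Fin (n - 1)))) :
    (2 * m / n : ℝ) ≤ laplacianEigenvalue G 2 ∧
      (laplacianEigenvalue G 2 = (2 * m / n : ℝ) ↔
        Even n ∧ Nonempty (G ≃g completeBipartiteGraph (Fin (n / 2)) (Fin (n / 2)))) := by
  subst hn hm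
  have hV : 2 ≤ Fintype.card V := by
    by_contra hlt
    obtain ⟨u⟩ := hconn.nonempty
    have hsub : Subsingleton V := Fintype.card_le_one_iff_subsingleton.1 (by omega)
    exact hstar (nonempty_iso_star hconn fun v hv => absurd (Subsingleton.elim v u) hv)
  have heq : (Even (Fintype.card V) ∧ Nonempty (G ≃g completeBipartiteGraph
      (Fin (Fintype.card V / 2)) (Fin (Fintype.card V / 2)))) →
      laplacianEigenvalue G 2 = 2 * G.edgeFinset.card / Fintype.card V := by
    rintro ⟨⟨h, hh⟩, hφ⟩
    have hh2 : Fintype.card V / 2 = h := by omega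
    rw [hh2] at hφ
    -- `K_{1,1}` is itself a star.
    have h2 : 2 ≤ h := by
      by_contra hlt
      have h1 : h = 1 := by omega
      subst h1
      exact hstar (by rwa [hh])
    obtain ⟨φ⟩ := hφ
    rw [laplacianEigenvalue_two_of_iso h2 φ, two_mul_card_edgeFinset_of_iso φ, hh]
    have : (h : ℝ) ≠ 0 := by positivity
    push_cast
    field_simp
    ring
  have hiso := exists_iso_of_laplacianEigenvalue_two_le hconn hstar hV
  refine ⟨?_, fun h => hiso h.le, heq⟩
  -- Strict inequality would still force `K_{h,h}`, where equality holds.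
  by_contra! hlt
  exact hlt.ne (heq (hiso hlt.le))
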